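/- Let $Q=(Q,\le,\odot)$ be a semicartesian quantale: $(Q,\le)$ is a complete lattice, $\odot$ is an associative binary operation on $Q$ that distributes over arbitrary joins in each variable, and $a\odot b\le a$ and $a\odot b\le b$ for all $a,b\in Q$ (neither commutativity nor a unit is assumed). View $Q$ as a small poset category and let $PSh(Q)$ be the category of functors $Q^{op}\to Set$. Let $Sh(Q)$ be the full subcategory of those presheaves $F$ that are sheaves: for every small (possibly empty) family $(u_i)_{i\in I}$ in $Q$ with $u=\bigvee_{i\in I}u_i$, and every family $(s_i\in F(u_i))_{i\in I}$ with $s_i|_{u_i\odot u_j}=s_j|_{u_i\odot u_j}$ for all $i,j\in I$, there is a unique $s\in F(u)$ with $s|_{u_i}=s_i$ for all $i\in I$. Put $\lambda=\max\{\mathrm{card}(Q)^+,\aleph_0\}$, which is a regular cardinal. Then: 1. $Sh(Q)$ is a $\lambda$-orthogonality class in $PSh(Q)$: there is a set $W$ of morphisms of $PSh(Q)$ with $\lambda$-presentable domains and codomains such that a presheaf $F$ is a sheaf if and only if, for every $f\colon X\to Y$ in $W$, every morphism $X\to F$ factors uniquely through $f$. 2. $Sh(Q)$ is a reflective subcategory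 of $PSh(Q)$: the inclusion $Sh(Q)\hookrightarrow PSh(Q)$ has a left adjoint (sheafification). 3. $Sh(Q)$ is closed in $PSh(Q)$ under small $\lambda$-filtered colimits, in particular under $\lambda$-directed colimits. 4. $Sh(Q)$ is locally $\lambda$-presentable. -/

import Mathlib

open CategoryTheory CategoryTheory.Limits Opposite

universe w v u

/-- A quantale is semicartesian if `a * b ≤ a` and `a * b ≤ b` for all `a`, `b`.
Neither commutativity nor a unit is required. -/
class IsSemicartesianQuantale (Q : Type u) [Semigroup Q] [CompleteLattice Q] [IsQuantale Q] :
    Prop where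
  mul_le_left (a b : Q) : a * b ≤ a
  mul_le_right (a b : Q) : a * b ≤ b

namespace QuantaleSheaf

/-- Presheaves of sets on `Q`, the quantale being viewed as a poset category. -/
abbrev PSh (Q : Type u) [CompleteLattice Q] : Type (u + 1) := Qᵒᵖ ⥤ Type u

/-- The restriction map `F u → F v` of a presheaf along `v ≤ u`. -/
def restr {Q : Type u} [CompleteLattice Q] (F : PSh Q) {v u : Q} (h : v ≤ u)
    (s : F.obj (op u)) : F.obj (op v) :=
  F.map (homOfLE h).op s

section

variable {Q : Type u} [Semigroup Q] [CompleteLattice Q] [IsQuantale Q]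
  [IsSemicartesianQuantale Q]

/-- A family `s i ∈ F (U i)` is compatible if `s i` and `s j` have the same restriction to
`U i * U j` for all indices `i`, `j`. -/
def Compatible (F : PSh Q) {I : Type u} (U : I → Q) (s : ∀ i, F.obj (op (U i))) : Prop :=
  ∀ i j : I,
    restr F (IsSemicartesianQuantale.mul_le_left (U i) (U j)) (s i) =
      restr F (IsSemicartesianQuantale.mul_le_right (U i) (U j)) (s j)

variable (Q) in
/-- A presheaf on `Q` is a sheaf if, for every (small, possibly empty) family `U` in `Q`, every
compatible family on `U` is the family of restrictions of exactly one section over `⨆ i, U i`. -/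
def IsSheaf : ObjectProperty (PSh Q) := fun F =>
  ∀ (I : Type u) (U : I → Q) (s : ∀ i, F.obj (op (U i))), Compatible F U s →
    ∃! t : F.obj (op (⨆ i, U i)), ∀ i, restr F (le_iSup U i) t = s i

variable (Q) in
/-- The category of sheaves on `Q`, a full subcategory of `PSh Q`. -/
abbrev Sh : Type (u + 1) := (IsSheaf Q).FullSubcategory

end

/-- The cardinal `max {card(Q)⁺, ℵ₀}`. -/
noncomputable def cardinalBound (Q : Type u) : Cardinal.{u} :=
  max (Order.succ (Cardinal.mk Q)) Cardinal.aleph0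

theorem cardinalBound_isRegular (Q : Type u) : (cardinalBound Q).IsRegular := by
  unfold cardinalBound
  rcases le_or_gt Cardinal.aleph0 (Cardinal.mk Q) with h | h
  · rw [max_eq_left (h.trans (Order.le_succ _))]
    exact Cardinal.isRegular_succ h
  · rw [max_eq_right (Order.succ_le_of_lt h)]
    exact Cardinal.isRegular_aleph0

instance fact_cardinalBound_isRegular (Q : Type u) : Fact (cardinalBound Q).IsRegular :=
  ⟨cardinalBound_isRegular Q⟩

end QuantaleSheaf

/-- A class `P` of objects of `C` is a `κ`-orthogonality class if it consists of exactly the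
objects `Z` orthogonal to some set `W` of morphisms between `κ`-presentable objects, i.e. such
that every morphism `X ⟶ Z` factors uniquely through `f`, for each `f : X ⟶ Y` in `W`. -/
def IsCardinalOrthogonalityClass {C : Type u} [Category.{v} C] (P : ObjectProperty C)
    (κ : Cardinal.{w}) [Fact κ.IsRegular] : Prop :=
  ∃ W : MorphismProperty C, MorphismProperty.IsSmall.{w} W ∧
    (∀ ⦃X Y : C⦄ (f : X ⟶ Y), W f → IsCardinalPresentable X κ ∧ IsCardinalPresentable Y κ) ∧
    P = W.isLocal

namespace QuantaleSheaf

section CompleteLattice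

variable {Q : Type u} [CompleteLattice Q]

/-! For each family `U`, the coequalizer of `∐ y(U i * U j) ⇉ ∐ y(U i)` represents compatible
families, so gluing along `U` is orthogonality to `coverDesc U` (`bijective_coverDesc_comp_iff`).
Families form a proper class; a set of them must suffice. Subsets of `Q` alone are not evidently
enough: as `v * v` may differ from `v`, a family repeating `v` also forces `F v → F (v * v)` to be
injective. Listing every element of a subset twice captures this (`restr_eq_of_compatible`), and
every family then reduces to its range. These families have fewer than `cardinalBound Q` members, so
the maps have presentable ends, and the general theory of local objects gives all four claims. -/

lemma yonedaEquiv_map_comp {F : PSh Q} {u v : Q} (h : v ≤ u) (a : yoneda.obj u ⟶ F) :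
    yonedaEquiv (yoneda.map (homOfLE h) ≫ a) = restr F h (yonedaEquiv a) :=
  (yonedaEquiv_naturality a (homOfLE h)).symm

lemma isCardinalPresentable_yoneda (κ : Cardinal.{u}) [Fact κ.IsRegular] (q : Q) :
    IsCardinalPresentable (yoneda.obj q : PSh Q) κ :=
  isCardinalPresentable_of_iso (uliftYonedaIsoYoneda.{u}.app q) κ

lemma isCardinalPresentable_sigma_yoneda (κ : Cardinal.{u}) [Fact κ.IsRegular]
    {J : Type u} (hJ : HasCardinalLT J κ) (V : J → Q) :
    IsCardinalPresentable (∐ fun j => (yoneda.obj (V j) : PSh Q)) κ := by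
  have (j : Discrete J) :
      IsCardinalPresentable ((Discrete.functor fun j => (yoneda.obj (V j) : PSh Q)).obj j) κ :=
    isCardinalPresentable_yoneda κ _
  exact isCardinalPresentable_of_isColimit _
    (colimit.isColimit (Discrete.functor fun j => (yoneda.obj (V j) : PSh Q))) κ
    (by simpa using hJ)

lemma restr_restr (F : PSh Q) {w v u : Q} (h : w ≤ v) (h' : v ≤ u) (s : F.obj (op u)) :
    restr F h (restr F h' s) = restr F (h.trans h') s := by
  simp only [restr, ← comp_apply, ← Functor.map_comp]
  rfl

lemma restr_self (F : PSh Q) {u : Q} (h : u ≤ u) (s : F.obj (op u)) : restr F h s = s :=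
  ConcreteCategory.congr_hom (F.map_id (op u)) s

end CompleteLattice

lemma hasCardinalLT_prod {X Y : Type u} {κ : Cardinal.{u}} (hκ : Cardinal.aleph0 ≤ κ)
    (hX : HasCardinalLT X κ) (hY : HasCardinalLT Y κ) : HasCardinalLT (X × Y) κ := by
  rw [hasCardinalLT_iff_cardinal_mk_lt] at *
  simpa using Cardinal.mul_lt_of_lt hκ hX hY

/-- The family on `S × Bool` in which each element of `S` is listed twice. -/
abbrev doubledFamily {Q : Type u} (S : Set Q) (p : S × ULift.{u} Bool) : Q := p.1

/-- The successor bounds `S`; the `ℵ₀` in the maximum absorbs the doubling when `Q` is finite. -/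
lemma hasCardinalLT_doubled {Q : Type u} (S : Set Q) :
    HasCardinalLT (S × ULift.{u} Bool) (cardinalBound Q) := by
  have hκ : Cardinal.aleph0 ≤ cardinalBound Q := le_max_right _ _
  refine hasCardinalLT_prod hκ ?_ (hasCardinalLT_of_finite _ _ hκ)
  rw [hasCardinalLT_iff_cardinal_mk_lt]
  exact (Cardinal.mk_set_le S).trans_lt ((Order.lt_succ _).trans_le (le_max_left _ _))

variable {Q : Type u} [Semigroup Q] [CompleteLattice Q] [IsQuantale Q]
  [IsSemicartesianQuantale Q]

section CoverColimit

variable {I : Type u} (U : I → Q)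

/-- The map `∐ y(U i * U j) ⟶ ∐ y(U i)` induced by `U i * U j ≤ U i`. -/
noncomputable def overlapFst :
    (∐ fun p : I × I => yoneda.obj (U p.1 * U p.2)) ⟶ ∐ fun i => yoneda.obj (U i) :=
  Sigma.desc fun p =>
    yoneda.map (homOfLE (IsSemicartesianQuantale.mul_le_left (U p.1) (U p.2))) ≫
      Sigma.ι (fun i => yoneda.obj (U i)) p.1

/-- The map `∐ y(U i * U j) ⟶ ∐ y(U j)` induced by `U i * U j ≤ U j`. -/
noncomputable def overlapSnd :
    (∐ fun p : I × I => yoneda.obj (U p.1 * U p.2)) ⟶ ∐ fun i => yoneda.obj (U i) :=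
  Sigma.desc fun p =>
    yoneda.map (homOfLE (IsSemicartesianQuantale.mul_le_right (U p.1) (U p.2))) ≫
      Sigma.ι (fun i => yoneda.obj (U i)) p.2

lemma ι_overlapFst (p : I × I) :
    Sigma.ι (fun p : I × I => yoneda.obj (U p.1 * U p.2)) p ≫ overlapFst U =
      yoneda.map (homOfLE (IsSemicartesianQuantale.mul_le_left (U p.1) (U p.2))) ≫
        Sigma.ι (fun i => yoneda.obj (U i)) p.1 :=
  Sigma.ι_desc _ _

lemma ι_overlapSnd (p : I × I) :
    Sigma.ι (fun p : I × I => yoneda.obj (U p.1 * U p.2)) p ≫ overlapSnd U =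
      yoneda.map (homOfLE (IsSemicartesianQuantale.mul_le_right (U p.1) (U p.2))) ≫
        Sigma.ι (fun i => yoneda.obj (U i)) p.2 :=
  Sigma.ι_desc _ _

/-- The presheaf representing compatible families on `U`. -/
noncomputable abbrev coverColimit : PSh Q := coequalizer (overlapFst U) (overlapSnd U)

/-- The canonical map from a representable on a member of the family `U`. -/
noncomputable def coverι (i : I) : yoneda.obj (U i) ⟶ coverColimit U :=
  Sigma.ι (fun i => yoneda.obj (U i)) i ≫ coequalizer.π (overlapFst U) (overlapSnd U)

lemma coverι_condition (i j : I) :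
    yoneda.map (homOfLE (IsSemicartesianQuantale.mul_le_left (U i) (U j))) ≫ coverι U i =
      yoneda.map (homOfLE (IsSemicartesianQuantale.mul_le_right (U i) (U j))) ≫ coverι U j := by
  have h := Sigma.ι (fun p : I × I => yoneda.obj (U p.1 * U p.2)) (i, j) ≫=
    coequalizer.condition (overlapFst U) (overlapSnd U)
  rwa [← Category.assoc, ← Category.assoc, ι_overlapFst, ι_overlapSnd, Category.assoc,
    Category.assoc] at h

lemma coverColimit_hom_ext {F : PSh Q} {g h : coverColimit U ⟶ F}
    (w : ∀ i, coverι U i ≫ g = coverι U i ≫ h) : g = h := by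
  apply coequalizer.hom_ext
  refine Sigma.hom_ext _ _ fun i => ?_
  simpa only [coverι, Category.assoc] using w i

lemma exists_coverColimit_desc {F : PSh Q} (a : ∀ i, yoneda.obj (U i) ⟶ F)
    (w : ∀ i j,
      yoneda.map (homOfLE (IsSemicartesianQuantale.mul_le_left (U i) (U j))) ≫ a i =
        yoneda.map (homOfLE (IsSemicartesianQuantale.mul_le_right (U i) (U j))) ≫ a j) :
    ∃ g : coverColimit U ⟶ F, ∀ i, coverι U i ≫ g = a i := by
  refine ⟨coequalizer.desc (Sigma.desc a) (Sigma.hom_ext _ _ fun p => ?_), fun i => ?_⟩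
  · simpa [overlapFst, overlapSnd] using w p.1 p.2
  · simp [coverι]

lemma exists_coverDesc :
    ∃ g : coverColimit U ⟶ yoneda.obj (⨆ i, U i),
      ∀ i, coverι U i ≫ g = yoneda.map (homOfLE (le_iSup U i)) :=
  exists_coverColimit_desc U _ fun i j => by
    rw [← Functor.map_comp, ← Functor.map_comp]
    rfl

/-- The comparison map from the presheaf of compatible families on `U` to the representable
presheaf on the supremum of `U`. -/
noncomputable def coverDesc : coverColimit U ⟶ yoneda.obj (⨆ i, U i) :=
  (exists_coverDesc U).choose

lemma coverι_coverDesc (i : I) :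
    coverι U i ≫ coverDesc U = yoneda.map (homOfLE (le_iSup U i)) :=
  (exists_coverDesc U).choose_spec i

/-- By Yoneda, precomposition with `coverDesc U` sends a section over the supremum to its family of
restrictions. -/
lemma bijective_coverDesc_comp_iff (F : PSh Q) :
    Function.Bijective (fun g : _ ⟶ F => coverDesc U ≫ g) ↔
      ∀ s : ∀ i, F.obj (op (U i)), Compatible F U s →
        ∃! t : F.obj (op (⨆ i, U i)), ∀ i, restr F (le_iSup U i) t = s i := by
  have key (b : coverColimit U ⟶ F) (s : ∀ i, F.obj (op (U i)))
      (hs : ∀ i, yonedaEquiv (coverι U i ≫ b) = s i) (g : yoneda.obj (⨆ i, U i) ⟶ F) :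
      coverDesc U ≫ g = b ↔ ∀ i, restr F (le_iSup U i) (yonedaEquiv g) = s i := by
    simp only [← hs, ← yonedaEquiv_map_comp, ← coverι_coverDesc, Category.assoc,
      EmbeddingLike.apply_eq_iff_eq]
    exact ⟨fun h i => by rw [h], coverColimit_hom_ext U⟩
  rw [Function.bijective_iff_existsUnique]
  refine ⟨fun H s hs => ?_, fun H b => ?_⟩
  · obtain ⟨b, hb⟩ := exists_coverColimit_desc U (fun i => yonedaEquiv.symm (s i)) fun i j =>
      yonedaEquiv.injective (by simpa [yonedaEquiv_map_comp] using hs i j)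
    refine (yonedaEquiv.existsUnique_congr fun {g} => ?_).1 (H b)
    exact key b s (fun i => by simp [hb]) g
  · refine (yonedaEquiv.existsUnique_congr fun {g} => ?_).2
      (H (fun i => yonedaEquiv (coverι U i ≫ b)) fun i j => ?_)
    · exact key b _ (fun _ => rfl) g
    · simp only [← yonedaEquiv_map_comp, ← Category.assoc, coverι_condition]

lemma isCardinalPresentable_coverColimit (κ : Cardinal.{u}) [Fact κ.IsRegular]
    (hI : HasCardinalLT I κ) : IsCardinalPresentable (coverColimit U) κ := by
  have hκ : Cardinal.aleph0 ≤ κ := Cardinal.IsRegular.aleph0_le Fact.out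
  have (k : WalkingParallelPair) :
      IsCardinalPresentable ((parallelPair (overlapFst U) (overlapSnd U)).obj k) κ := by
    cases k
    · exact isCardinalPresentable_sigma_yoneda κ (hasCardinalLT_prod hκ hI hI) _
    · exact isCardinalPresentable_sigma_yoneda κ hI _
  exact isCardinalPresentable_of_isColimit _
    (colimit.isColimit (parallelPair (overlapFst U) (overlapSnd U))) κ
    (.of_le (by simp only [hasCardinalLT_aleph0_iff]; infer_instance) hκ)

end CoverColimit

variable (Q) in
/-- The comparison maps of the families that list each element of a subset of `Q` twice. -/
noncomputable def coverMorphisms : MorphismProperty (PSh Q) :=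
  MorphismProperty.ofHoms fun S : Set Q => coverDesc (doubledFamily S)

lemma isLocal_coverMorphisms_iff (F : PSh Q) :
    (coverMorphisms Q).isLocal F ↔
      ∀ (S : Set Q) (s : ∀ p, F.obj (op (doubledFamily S p))),
        Compatible F (doubledFamily S) s →
          ∃! t : F.obj (op (⨆ p, doubledFamily S p)),
            ∀ p, restr F (le_iSup (doubledFamily S) p) t = s p := by
  simp only [← bijective_coverDesc_comp_iff]
  exact ⟨fun h S => h _ ⟨S⟩, fun h X Y f ⟨S⟩ => h S⟩

/-- Placed on the two copies of `v`, the sections `x` and `y` form a compatible family; its gluing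
restricts to both. -/
lemma restr_eq_of_compatible {F : PSh Q} (hF : (coverMorphisms Q).isLocal F) {v : Q}
    {x y : F.obj (op v)}
    (hxy : restr F (IsSemicartesianQuantale.mul_le_left v v) x =
      restr F (IsSemicartesianQuantale.mul_le_left v v) y) : x = y := by
  rw [isLocal_coverMorphisms_iff] at hF
  let s (p : ({v} : Set Q) × ULift.{u} Bool) : F.obj (op (doubledFamily {v} p)) :=
    restr F p.1.2.le (cond p.2.down x y)
  obtain ⟨t, ht, -⟩ := hF {v} s (by
    rintro ⟨⟨_, rfl⟩, ⟨a⟩⟩ ⟨⟨_, rfl⟩, ⟨b⟩⟩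
    simp only [s, restr_restr]
    cases a <;> cases b
    exacts [rfl, hxy.symm, hxy, rfl])
  have hx := ht ⟨⟨v, rfl⟩, ⟨true⟩⟩
  have hy := ht ⟨⟨v, rfl⟩, ⟨false⟩⟩
  rw [← restr_self F le_rfl x, ← restr_self F le_rfl y]
  exact hx.symm.trans hy

lemma isSheaf_of_isLocal_coverMorphisms {F : PSh Q} (hF : (coverMorphisms Q).isLocal F) :
    IsSheaf Q F := by
  intro I U s hs
  -- Compatibility gives agreement on `v * v` only; injectivity of restriction lifts it to `v`.
  have hs' {i j : I} {v : Q} (hi : v ≤ U i) (hj : v ≤ U j) (hv : v * v ≤ U i * U j) :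
      restr F hi (s i) = restr F hj (s j) := by
    apply restr_eq_of_compatible hF
    have := congrArg (restr F hv) (hs i j)
    simpa only [restr_restr] using this
  -- One index is chosen per value of `U`; by `hs'` the choice does not affect the section.
  choose σ hσ using fun v : Set.range U => v.2
  have hsup : ⨆ p, doubledFamily (Set.range U) p = ⨆ i, U i := by
    apply le_antisymm
    · exact iSup_le fun ⟨⟨_, i, rfl⟩, _⟩ => le_iSup U i
    · exact iSup_le fun i =>
        le_iSup (doubledFamily (Set.range U)) ⟨⟨U i, i, rfl⟩, ⟨true⟩⟩
  have H := (isLocal_coverMorphisms_iff F).1 hF (Set.range U)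
    (fun p => restr F (hσ p.1).ge (s (σ p.1))) (fun p q => by
      have := congrArg (restr F (mul_le_mul' (hσ p.1).ge (hσ q.1).ge)) (hs (σ p.1) (σ q.1))
      simpa only [restr_restr] using this)
  obtain ⟨t, ht, ht'⟩ := H
  refine ⟨restr F hsup.ge t, fun i => ?_, fun t₁ ht₁ => ?_⟩
  · have := ht ⟨⟨U i, i, rfl⟩, ⟨true⟩⟩
    rw [restr_restr]
    refine this.trans ?_
    rw [← restr_self F le_rfl (s i)]
    exact hs' _ _ (mul_le_mul' (hσ _).ge le_rfl)
  · rw [← ht' (restr F hsup.le t₁) fun p => ?_, restr_restr, restr_self]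
    rw [restr_restr, ← ht₁, restr_restr]

lemma isSheaf_eq_isLocal_coverMorphisms : IsSheaf Q = (coverMorphisms Q).isLocal := by
  ext F
  refine ⟨fun hF => ?_, isSheaf_of_isLocal_coverMorphisms⟩
  rw [isLocal_coverMorphisms_iff]
  exact fun S s => hF _ _ s

lemma isCardinalPresentable_of_coverMorphisms ⦃X Y : PSh Q⦄ (f : X ⟶ Y)
    (hf : coverMorphisms Q f) :
    IsCardinalPresentable X (cardinalBound Q) ∧ IsCardinalPresentable Y (cardinalBound Q) := by
  obtain ⟨S⟩ := hf
  exact ⟨isCardinalPresentable_coverColimit _ _ (hasCardinalLT_doubled S),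
    isCardinalPresentable_yoneda _ _⟩

instance isSmall_coverMorphisms : MorphismProperty.IsSmall.{u} (coverMorphisms Q) := by
  unfold coverMorphisms
  infer_instance

end QuantaleSheaf

theorem mainTheorem7 (Q : Type u) [Semigroup Q] [CompleteLattice Q] [IsQuantale Q]
    [IsSemicartesianQuantale Q] :
    -- sheaves form an orthogonality class in presheaves
    IsCardinalOrthogonalityClass (QuantaleSheaf.IsSheaf Q) (QuantaleSheaf.cardinalBound Q) ∧
    -- the inclusion functor has a left adjoint
    Nonempty (Reflective (QuantaleSheaf.IsSheaf Q).ι) ∧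
    -- closure under filtered (in particular, directed) colimits for this cardinal
    (∀ (J : Type u) [SmallCategory J] [IsCardinalFiltered J (QuantaleSheaf.cardinalBound Q)],
      (QuantaleSheaf.IsSheaf Q).IsClosedUnderColimitsOfShape J) ∧
    -- local presentability
    IsCardinalLocallyPresentable (QuantaleSheaf.Sh Q) (QuantaleSheaf.cardinalBound Q) := by
  have hW := QuantaleSheaf.isCardinalPresentable_of_coverMorphisms (Q := Q)
  unfold QuantaleSheaf.Sh
  rw [QuantaleSheaf.isSheaf_eq_isLocal_coverMorphisms]
  refine ⟨⟨_, inferInstance, hW, rfl⟩, ?_, fun J _ _ => ?_, ?_⟩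
  · have := MorphismProperty.isRightAdjoint_ι_isLocal _ _ hW
    exact ⟨{ L := _, adj := Adjunction.ofIsRightAdjoint _ }⟩
  · exact MorphismProperty.isClosedUnderColimitsOfShape_isLocal _ J _ hW
  · exact MorphismProperty.isLocallyPresentable_isLocal _ _ hW
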